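/- **Proposition 3.3.** Let $R$ be an associative ring with identity, $M$ a left $R$-module and $\mathcal{A}$ a family of submodules of $M$. A left $R$-module $T$ is *$M$-$\mathcal{A}$-injective* if for all $A\in\mathcal{A}$ every homomorphism $A\to T$ extends to $M$. It is *strongly $M$-$\mathcal{A}$-injective* if for every left $R$-module $Y$ and every submodule $X\subseteq Y$ with $Y/X\cong M/A$ for some $A\in\mathcal{A}$, every homomorphism $X\to T$ extends to $Y$. The classes of these modules are denoted $M$-$\mathcal{A}I$ and $SM$-$\mathcal{A}I$. A right $R$-module $T$ is *$M$-$\mathcal{A}$-flat* if $T\otimes_R A\to T\otimes_R M$ is injective for all $A\in\mathcal{A}$. The module $M$ is *$\mathcal{A}$-coherent* if every $A\in\mathcal{A}$ is finitely presented, and is a *$P\mathcal{A}$-module* if every $A\in\mathcal{A}$ is projective. For a class $\mathcal{X}$ of left $R$-modules, an *$\mathcal{X}$-cover* of a left $R$-module $N$ is a homomorphism $\varphi:F\to N$ with $F\in\mathcal{X}$ such that every homomorphism $F'\to N$ with $F'\in\mathcal{X}$ factors through $\varphi$, and every endomorphism $g$ of $F$ with $\varphi g=\varphi$ is an automorphism;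 it is *monic* if $\varphi$ is injective. For $\mathcal{X}\in\{M\text{-}\mathcal{A}I,\ SM\text{-}\mathcal{A}I\}$ consider the conditions: 1. $M$ is a $P\mathcal{A}$-module. 2. Every quotient module of a module in $\mathcal{X}$ is in $\mathcal{X}$. 3. $M$ is $\mathcal{A}$-coherent and every submodule of an $M$-$\mathcal{A}$-flat right $R$-module is $M$-$\mathcal{A}$-flat. 4. Every left $R$-module has a monic $\mathcal{X}$-cover. When $\mathcal{X}=SM\text{-}\mathcal{A}I$, assume throughout that $M$ is projective; when $\mathcal{X}=M\text{-}\mathcal{A}I$, $M$ is arbitrary. Then, for each of the two choices of $\mathcal{X}$: - (1)$\Rightarrow$(2). - If $M$ is projective, then (2)$\Rightarrow$(1) and (4)$\Rightarrow$(2). - If $M$ is finitely presented, then (3)$\Rightarrow$(2). - If every $A\in\mathcal{A}$ is finitely generated and $M$ is projective, then (2)$\Rightarrow$(3). - If $M$ is $\mathcal{A}$-coherent, then (2)$\Rightarrow$(4). -/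

import Mathlib

open scoped TensorProduct

universe u

/-- The additive relations `(t r) ⊗ a = t ⊗ (r a)` inside `T ⊗[ℤ] A`, for a right `R`-module `T`
(that is, a module over `Rᵐᵒᵖ`) and a left `R`-module `A`. -/
def balancedRelations (R : Type u) [Ring R] (T : Type u) [AddCommGroup T] [Module Rᵐᵒᵖ T]
    (A : Type u) [AddCommGroup A] [Module R A] : AddSubgroup (T ⊗[ℤ] A) :=
  AddSubgroup.closure
    {x | ∃ (t : T) (r : R) (a : A), x = (MulOpposite.op r • t) ⊗ₜ[ℤ] a - t ⊗ₜ[ℤ] (r • a)}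

/-- The tensor product `T ⊗_R A` of a right `R`-module `T` and a left `R`-module `A` over a ring
`R` that need not be commutative; it is an abelian group. -/
abbrev BalancedTensor (R : Type u) [Ring R] (T : Type u) [AddCommGroup T] [Module Rᵐᵒᵖ T]
    (A : Type u) [AddCommGroup A] [Module R A] : Type u :=
  (T ⊗[ℤ] A) ⧸ balancedRelations R T A

theorem balancedRelations_le_comap {R : Type u} [Ring R]
    (T : Type u) [AddCommGroup T] [Module Rᵐᵒᵖ T]
    {A B : Type u} [AddCommGroup A] [Module R A] [AddCommGroup B] [Module R B] (f : A →ₗ[R] B) :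
    balancedRelations R T A ≤ (balancedRelations R T B).comap
      (LinearMap.lTensor T f.toAddMonoidHom.toIntLinearMap).toAddMonoidHom := by
  refine (AddSubgroup.closure_le _).2 ?_
  rintro x ⟨t, r, a, rfl⟩
  refine AddSubgroup.subset_closure ⟨t, r, f a, ?_⟩
  simp [map_sub]

/-- The map `T ⊗_R f : T ⊗_R A → T ⊗_R B`, `t ⊗ a ↦ t ⊗ f a`. -/
def BalancedTensor.map {R : Type u} [Ring R] (T : Type u) [AddCommGroup T] [Module Rᵐᵒᵖ T]
    {A B : Type u} [AddCommGroup A] [Module R A] [AddCommGroup B] [Module R B] (f : A →ₗ[R] B) :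
    BalancedTensor R T A →+ BalancedTensor R T B :=
  QuotientAddGroup.map _ _ (LinearMap.lTensor T f.toAddMonoidHom.toIntLinearMap).toAddMonoidHom
    (balancedRelations_le_comap T f)

/-- `T` is `M`-`𝒜`-injective: `Hom(M, T) → Hom(A, T)` is onto for all `A ∈ 𝒜`. -/
def IsRelInjective {R : Type u} [Ring R] {M : Type u} [AddCommGroup M] [Module R M]
    (𝒜 : Set (Submodule R M)) (T : Type u) [AddCommGroup T] [Module R T] : Prop :=
  ∀ A ∈ 𝒜, ∀ f : A →ₗ[R] T, ∃ g : M →ₗ[R] T, g ∘ₗ A.subtype = f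

/-- `T` is strongly `M`-`𝒜`-injective: `Hom(Y, T) → Hom(X, T)` is onto for every module `Y` and
every submodule `X` of `Y` such that `Y / X ≅ M / A` for some `A ∈ 𝒜`. -/
def IsStronglyRelInjective {R : Type u} [Ring R] {M : Type u} [AddCommGroup M] [Module R M]
    (𝒜 : Set (Submodule R M)) (T : Type u) [AddCommGroup T] [Module R T] : Prop :=
  ∀ A ∈ 𝒜, ∀ (Y : Type u) [AddCommGroup Y] [Module R Y] (X : Submodule R Y),
    Nonempty ((Y ⧸ X) ≃ₗ[R] (M ⧸ A)) →
      ∀ f : X →ₗ[R] T, ∃ g : Y →ₗ[R] T, g ∘ₗ X.subtype = f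

/-- The right `R`-module `T` is `M`-`𝒜`-flat: `T ⊗_R A → T ⊗_R M` is injective for all `A ∈ 𝒜`. -/
def IsRelFlat {R : Type u} [Ring R] {M : Type u} [AddCommGroup M] [Module R M]
    (𝒜 : Set (Submodule R M)) (T : Type u) [AddCommGroup T] [Module Rᵐᵒᵖ T] : Prop :=
  ∀ A ∈ 𝒜, Function.Injective (BalancedTensor.map T A.subtype)

/-- `M` is `𝒜`-coherent: every `A ∈ 𝒜` is finitely presented. -/
def IsRelCoherent {R : Type u} [Ring R] {M : Type u} [AddCommGroup M] [Module R M]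
    (𝒜 : Set (Submodule R M)) : Prop :=
  ∀ A ∈ 𝒜, Module.FinitePresentation R A

/-- `M` is a `P𝒜`-module: every `A ∈ 𝒜` is projective. -/
def IsPModule {R : Type u} [Ring R] {M : Type u} [AddCommGroup M] [Module R M]
    (𝒜 : Set (Submodule R M)) : Prop :=
  ∀ A ∈ 𝒜, Module.Projective R A

/-- A class of left `R`-modules. -/
abbrev ModClass (R : Type u) [Ring R] : Type (u + 1) :=
  ∀ (N : Type u) [AddCommGroup N] [Module R N], Prop

/-- The class `M`-`𝒜I` of `M`-`𝒜`-injective left modules. -/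
def relInjectives {R : Type u} [Ring R] {M : Type u} [AddCommGroup M] [Module R M]
    (𝒜 : Set (Submodule R M)) : ModClass R :=
  fun N _ _ => IsRelInjective 𝒜 N

/-- The class `SM`-`𝒜I` of strongly `M`-`𝒜`-injective left modules. -/
def stronglyRelInjectives {R : Type u} [Ring R] {M : Type u} [AddCommGroup M] [Module R M]
    (𝒜 : Set (Submodule R M)) : ModClass R :=
  fun N _ _ => IsStronglyRelInjective 𝒜 N

/-- Every quotient module of a module in the class `𝒳` is in `𝒳`. -/
def IsQuotientClosed {R : Type u} [Ring R] (𝒳 : ModClass R) : Prop :=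
  ∀ (B : Type u) [AddCommGroup B] [Module R B], 𝒳 B → ∀ C : Submodule R B, 𝒳 (B ⧸ C)

/-- `φ : F → N` is an `𝒳`-precover: `F ∈ 𝒳` and every map from a member of `𝒳` to `N` factors
through `φ`. -/
def IsPrecover {R : Type u} [Ring R] (𝒳 : ModClass R) {F N : Type u} [AddCommGroup F] [Module R F]
    [AddCommGroup N] [Module R N] (φ : F →ₗ[R] N) : Prop :=
  𝒳 F ∧ ∀ (F' : Type u) [AddCommGroup F'] [Module R F'], 𝒳 F' →
    ∀ ψ : F' →ₗ[R] N, ∃ θ : F' →ₗ[R] F, φ ∘ₗ θ = ψ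

/-- `φ : F → N` is an `𝒳`-cover: an `𝒳`-precover such that every endomorphism `g` of `F` with
`φ g = φ` is an automorphism. -/
def IsCover {R : Type u} [Ring R] (𝒳 : ModClass R) {F N : Type u} [AddCommGroup F] [Module R F]
    [AddCommGroup N] [Module R N] (φ : F →ₗ[R] N) : Prop :=
  IsPrecover 𝒳 φ ∧ ∀ g : F →ₗ[R] F, φ ∘ₗ g = φ → Function.Bijective g

/-- Every left `R`-module has a monic `𝒳`-cover. -/
def HasMonicCovers {R : Type u} [Ring R] (𝒳 : ModClass R) : Prop :=
  ∀ (N : Type u) [AddCommGroup N] [Module R N],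
    ∃ (F : Type u) (_ : AddCommGroup F) (_ : Module R F) (φ : F →ₗ[R] N),
      IsCover 𝒳 φ ∧ Function.Injective φ

/-- Every submodule of an `M`-`𝒜`-flat right module is `M`-`𝒜`-flat. -/
def RelFlatSubmoduleClosed {R : Type u} [Ring R] {M : Type u} [AddCommGroup M] [Module R M]
    (𝒜 : Set (Submodule R M)) : Prop :=
  ∀ (T : Type u) [AddCommGroup T] [Module Rᵐᵒᵖ T], IsRelFlat 𝒜 T →
    ∀ U : Submodule Rᵐᵒᵖ T, IsRelFlat 𝒜 U

/-! ### Relative injectivity, quotients and monic covers. -/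

section RelInjective

variable {R : Type u} [Ring R] {M : Type u} [AddCommGroup M] [Module R M]
  {𝒜 : Set (Submodule R M)}

/-! For projective `M` the two classes coincide (`stronglyRelInjectives_eq`), so only
`relInjectives` needs work. Projectivity of the members of `𝒜` is tied to quotient closure by
lifting along quotient maps and by embedding modules into injectives. A monic cover of a quotient `B
⧸ C` is onto, hence an isomorphism; conversely, under quotient closure and finite generation, the
largest relatively injective submodule is a monic cover.

The flatness condition is handled by character duality, `⁺` denoting characters into `ℚ/ℤ`. Always,
`T` is flat iff `T⁺` is injective, by tensor-hom adjunction. For left modules, the pairing `B⁺ ⊗ A →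
Hom(A, B)⁺` is onto for `A` finitely generated and injective for `A` finitely presented, which
relates injectivity of `B` to flatness of `B⁺`. Submodules and quotients are exchanged by `⁺`. -/

theorem IsStronglyRelInjective.isRelInjective {T : Type u} [AddCommGroup T] [Module R T]
    (h : IsStronglyRelInjective 𝒜 T) : IsRelInjective 𝒜 T :=
  fun A hA f => h A hA M A ⟨LinearEquiv.refl R _⟩ f

/-- Projectivity lifts `M → M ⧸ A ≅ Y ⧸ X` to `h : M → Y` with `h⁻¹(X) = A`. Then `Y` is the pushout
of `X` and `M` along `A`, so `f` glues with an extension to `M` of `f ∘ h` on `A`. -/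
theorem IsRelInjective.isStronglyRelInjective [Module.Projective R M]
    {T : Type u} [AddCommGroup T] [Module R T]
    (hT : IsRelInjective 𝒜 T) : IsStronglyRelInjective 𝒜 T := by
  rintro A hA Y _ _ X ⟨e⟩ f
  obtain ⟨h, hh⟩ := Module.projective_lifting_property X.mkQ (e.symm.toLinearMap ∘ₗ A.mkQ)
    X.mkQ_surjective
  have hmk (m : M) : X.mkQ (h m) = e.symm (A.mkQ m) := LinearMap.congr_fun hh m
  have hmem (m : M) : h m ∈ X ↔ m ∈ A := by
    rw [← Submodule.Quotient.mk_eq_zero, ← Submodule.mkQ_apply, hmk,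
      LinearEquiv.map_eq_zero_iff, Submodule.mkQ_apply, Submodule.Quotient.mk_eq_zero]
  obtain ⟨g, hg⟩ := hT A hA (f ∘ₗ h.restrict (fun m hm => (hmem m).2 hm))
  have hg' (m : M) (hm : h m ∈ X) : g m = f ⟨h m, hm⟩ :=
    LinearMap.congr_fun hg ⟨m, (hmem m).1 hm⟩
  have hsurj : Function.Surjective (X.subtype.coprod h) := by
    intro y
    obtain ⟨m, hm⟩ := A.mkQ_surjective (e (X.mkQ y))
    have hy : y - h m ∈ X := by
      rw [← Submodule.Quotient.mk_eq_zero, ← Submodule.mkQ_apply, map_sub, hmk, hm]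
      simp
    exact ⟨(⟨_, hy⟩, m), by simp⟩
  have hker : LinearMap.ker (X.subtype.coprod h) ≤ LinearMap.ker (f.coprod g) := by
    rintro ⟨x, m⟩ hxm
    have hxm' : (x : Y) + h m = 0 := by simpa using hxm
    have hx : h m = ((-x : X) : Y) := by
      rw [Submodule.coe_neg]; exact (neg_eq_of_add_eq_zero_right hxm').symm
    have hm : h m ∈ X := hx ▸ (-x).2
    have : (⟨h m, hm⟩ : X) = -x := Subtype.ext hx
    simp [hg' m hm, this]
  let E := (X.subtype.coprod h).quotKerEquivOfSurjective hsurj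
  refine ⟨(LinearMap.ker (X.subtype.coprod h)).liftQ (f.coprod g) hker ∘ₗ E.symm.toLinearMap, ?_⟩
  ext x
  have : E.symm (x : Y) = Submodule.Quotient.mk (x, 0) := by
    rw [LinearEquiv.symm_apply_eq]
    simp [E]
  simp [this]

theorem stronglyRelInjectives_eq [Module.Projective R M] :
    stronglyRelInjectives 𝒜 = relInjectives 𝒜 := by
  funext N _ _
  exact propext ⟨fun h => h.isRelInjective, fun h => h.isStronglyRelInjective⟩

theorem IsRelInjective.of_equiv {T T' : Type u} [AddCommGroup T] [Module R T] [AddCommGroup T']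
    [Module R T'] (hT : IsRelInjective 𝒜 T) (e : T ≃ₗ[R] T') : IsRelInjective 𝒜 T' := by
  intro A hA f
  obtain ⟨g, hg⟩ := hT A hA (e.symm.toLinearMap ∘ₗ f)
  refine ⟨e.toLinearMap ∘ₗ g, ?_⟩
  rw [LinearMap.comp_assoc, hg]
  ext
  simp

theorem IsRelInjective.prod {T T' : Type u} [AddCommGroup T] [Module R T] [AddCommGroup T']
    [Module R T'] (hT : IsRelInjective 𝒜 T) (hT' : IsRelInjective 𝒜 T') :
    IsRelInjective 𝒜 (T × T') := by
  intro A hA f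
  obtain ⟨g, hg⟩ := hT A hA (LinearMap.fst R T T' ∘ₗ f)
  obtain ⟨g', hg'⟩ := hT' A hA (LinearMap.snd R T T' ∘ₗ f)
  refine ⟨g.prod g', LinearMap.ext fun a => Prod.ext ?_ ?_⟩
  · exact LinearMap.congr_fun hg a
  · exact LinearMap.congr_fun hg' a

theorem IsQuotientClosed.relInjective_of_surjective (h : IsQuotientClosed (relInjectives 𝒜))
    {T T' : Type u} [AddCommGroup T] [Module R T] [AddCommGroup T'] [Module R T']
    (hT : IsRelInjective 𝒜 T) (f : T →ₗ[R] T') (hf : Function.Surjective f) :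
    IsRelInjective 𝒜 T' :=
  IsRelInjective.of_equiv (h T hT (LinearMap.ker f)) (f.quotKerEquivOfSurjective hf)

theorem IsPModule.isQuotientClosed (h : IsPModule 𝒜) : IsQuotientClosed (relInjectives 𝒜) := by
  intro B _ _ hB C A hA f
  have := h A hA
  obtain ⟨f', hf'⟩ := Module.projective_lifting_property C.mkQ f C.mkQ_surjective
  obtain ⟨g, hg⟩ := hB A hA f'
  exact ⟨C.mkQ ∘ₗ g, by rw [LinearMap.comp_assoc, hg, hf']⟩

open CategoryTheory in
theorem exists_injective_module_embedding (B : Type u) [AddCommGroup B] [Module R B] :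
    ∃ (E : Type u) (_ : AddCommGroup E) (_ : Module R E) (i : B →ₗ[R] E),
      Module.Injective R E ∧ Function.Injective i := by
  obtain ⟨J, hJ, i, hi⟩ := (EnoughInjectives.presentation (ModuleCat.of R B)).some
  exact ⟨J, inferInstance, inferInstance, i.hom,
    Module.injective_module_of_injective_object R J (inj := hJ),
    (ModuleCat.mono_iff_injective i).mp hi⟩

/-- To lift `f : A → Q` along `p : B → Q`, embed `B` in an injective `E`, so that `Q` embeds in `E ⧸
K`. This quotient is relatively injective, so `f` extends to `M → E ⧸ K`, which lifts to `E` since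
`M` is projective; on `A` the lift lands in `B`. -/
theorem IsQuotientClosed.isPModule [Module.Projective R M]
    (h : IsQuotientClosed (relInjectives 𝒜)) : IsPModule 𝒜 := by
  intro A hA
  refine Module.Projective.of_lifting_property fun {B Q} _ _ _ _ p f hp => ?_
  obtain ⟨E, _, _, i, hE, hi⟩ := exists_injective_module_embedding (R := R) B
  let K : Submodule R E := (LinearMap.ker p).map i
  have hEinj : IsRelInjective 𝒜 E := fun A' _ f' => by
    obtain ⟨g, hg⟩ := hE.out A'.subtype A'.injective_subtype f'
    exact ⟨g, LinearMap.ext hg⟩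
  let j : Q →ₗ[R] E ⧸ K := ((LinearMap.ker p).mapQ K i (Submodule.le_comap_map _ _)) ∘ₗ
    (p.quotKerEquivOfSurjective hp).symm.toLinearMap
  have hj (b : B) : j (p b) = K.mkQ (i b) := by
    have : (p.quotKerEquivOfSurjective hp).symm (p b) = Submodule.Quotient.mk b := by
      rw [LinearEquiv.symm_apply_eq]
      simp
    simp [j, this]
  obtain ⟨g, hg⟩ := h E hEinj K A hA (j ∘ₗ f)
  obtain ⟨g', hg'⟩ := Module.projective_lifting_property K.mkQ g K.mkQ_surjective
  -- `g' a` differs from `i b` by an element of `K = i (ker p)`; absorbing it into `b` leaves `p b`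
  -- unchanged.
  have key (a : A) : ∃ b, i b = g' a ∧ p b = f a := by
    obtain ⟨b, hb⟩ := hp (f a)
    have h1 : K.mkQ (g' a) = K.mkQ (i b) := by
      rw [← hj, hb]
      exact (LinearMap.congr_fun hg' (a : M)).trans (LinearMap.congr_fun hg a)
    obtain ⟨k, hk, hk'⟩ := (Submodule.Quotient.eq K).1 h1
    refine ⟨k + b, by rw [map_add, hk', sub_add_cancel], ?_⟩
    rw [map_add, LinearMap.mem_ker.1 hk, hb, zero_add]
  have hrange (a : A) : (g' ∘ₗ A.subtype) a ∈ LinearMap.range i :=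
    let ⟨b, hb, _⟩ := key a
    ⟨b, hb⟩
  let e := LinearEquiv.ofInjective i hi
  refine ⟨e.symm.toLinearMap ∘ₗ (g' ∘ₗ A.subtype).codRestrict _ hrange, LinearMap.ext fun a => ?_⟩
  obtain ⟨b, hb, hb'⟩ := key a
  have : e.symm ((g' ∘ₗ A.subtype).codRestrict _ hrange a) = b := by
    rw [LinearEquiv.symm_apply_eq]
    exact Subtype.ext hb.symm
  simp only [LinearMap.comp_apply, LinearEquiv.coe_coe]
  rw [this, hb']

theorem HasMonicCovers.isQuotientClosed (h : HasMonicCovers (relInjectives 𝒜)) :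
    IsQuotientClosed (relInjectives 𝒜) := by
  intro B _ _ hB C
  obtain ⟨F, _, _, φ, ⟨⟨hF, hφ⟩, -⟩, hinj⟩ := h (B ⧸ C)
  obtain ⟨θ, hθ⟩ := hφ B hB C.mkQ
  have hsurj : Function.Surjective φ := fun x => by
    obtain ⟨b, rfl⟩ := C.mkQ_surjective x
    exact ⟨θ b, LinearMap.congr_fun hθ b⟩
  exact IsRelInjective.of_equiv hF (LinearEquiv.ofBijective φ ⟨hinj, hsurj⟩)

/-- The supremum of a directed set of relatively injective submodules is relatively injective if
all members of `𝒜` are finitely generated. -/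
theorem IsRelInjective.sSup_of_directedOn (hfg : ∀ A ∈ 𝒜, A.FG)
    {N : Type u} [AddCommGroup N] [Module R N] {s : Set (Submodule R N)} (hne : s.Nonempty)
    (hdir : DirectedOn (· ≤ ·) s) (hs : ∀ S ∈ s, IsRelInjective 𝒜 S) :
    IsRelInjective 𝒜 (sSup s : Submodule R N) := by
  intro A hA f
  have : Module.Finite R A := Module.Finite.iff_fg.2 (hfg A hA)
  -- A finitely generated image already lies in one member of the directed family, where the
  -- extension can be made.
  have hc : IsCompactElement (LinearMap.range ((sSup s).subtype ∘ₗ f)) :=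
    (Submodule.fg_iff_compact _).1 (Module.Finite.iff_fg.1 inferInstance)
  obtain ⟨S, hS, hle⟩ :=
    (CompleteLattice.isCompactElement_iff_le_of_directed_sSup_le _ _).1 hc s hne hdir (by
      rintro _ ⟨a, rfl⟩
      exact (f a).2)
  obtain ⟨g, hg⟩ := hs S hS A hA
    (((sSup s).subtype ∘ₗ f).codRestrict S fun a => hle (LinearMap.mem_range_self _ a))
  refine ⟨Submodule.inclusion (le_sSup hS) ∘ₗ g, LinearMap.ext fun a => Subtype.ext ?_⟩
  exact congrArg (fun x : S => (x : N)) (LinearMap.congr_fun hg a)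

/-- The relatively injective submodules of `N` are directed, as `S ⊔ S'` is a quotient of `S × S'`,
so there is a largest one. It contains the image of every map from the class. -/
theorem IsQuotientClosed.hasMonicCovers (hfg : ∀ A ∈ 𝒜, A.FG)
    (h : IsQuotientClosed (relInjectives 𝒜)) : HasMonicCovers (relInjectives 𝒜) := by
  intro N _ _
  let s : Set (Submodule R N) := {S | IsRelInjective 𝒜 S}
  have hne : s.Nonempty := ⟨⊥, fun A _ f => ⟨0, LinearMap.ext fun _ => Subsingleton.elim _ _⟩⟩
  have hdir : DirectedOn (· ≤ ·) s := by
    intro S hS S' hS'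
    refine ⟨S ⊔ S', ?_, le_sup_left, le_sup_right⟩
    refine h.relInjective_of_surjective (IsRelInjective.prod hS hS')
      ((Submodule.inclusion le_sup_left).coprod (Submodule.inclusion le_sup_right)) ?_
    rintro ⟨x, hx⟩
    obtain ⟨y, hy, z, hz, rfl⟩ := Submodule.mem_sup.1 hx
    exact ⟨(⟨y, hy⟩, ⟨z, hz⟩), Subtype.ext rfl⟩
  have hsup : IsRelInjective 𝒜 (sSup s : Submodule R N) :=
    IsRelInjective.sSup_of_directedOn hfg hne hdir fun _ => id
  refine ⟨(sSup s : Submodule R N), inferInstance, inferInstance, (sSup s).subtype,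
    ⟨⟨hsup, ?_⟩, ?_⟩, (sSup s).injective_subtype⟩
  · intro F' _ _ hF' ψ
    have hψ : LinearMap.range ψ ∈ s :=
      h.relInjective_of_surjective hF' ψ.rangeRestrict ψ.surjective_rangeRestrict
    exact ⟨ψ.codRestrict _ fun x => le_sSup hψ (LinearMap.mem_range_self ψ x), rfl⟩
  · intro g hg
    have : g = LinearMap.id :=
      LinearMap.ext fun x => Subtype.ext (LinearMap.congr_fun hg x)
    rw [this]
    exact Function.bijective_id

end RelInjective

/-! ### Pure tensors and the universal property of `T ⊗_R A`. -/

namespace BalancedTensor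

variable {R : Type u} [Ring R] {T : Type u} [AddCommGroup T] [Module Rᵐᵒᵖ T]
  {A B : Type u} [AddCommGroup A] [Module R A] [AddCommGroup B] [Module R B]

/-- The pure tensor `t ⊗ a` in `T ⊗_R A`, additive in both variables. -/
def tmul (R : Type u) [Ring R] {T : Type u} [AddCommGroup T] [Module Rᵐᵒᵖ T]
    {A : Type u} [AddCommGroup A] [Module R A] : T →+ A →+ BalancedTensor R T A :=
  AddMonoidHom.mk' (fun t => AddMonoidHom.mk' (fun a => QuotientAddGroup.mk (t ⊗ₜ[ℤ] a))
    fun a b => by rw [TensorProduct.tmul_add]; rfl)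
    fun s t => by ext a; simp only [AddMonoidHom.mk'_apply, TensorProduct.add_tmul]; rfl

theorem smul_tmul (r : R) (t : T) (a : A) :
    tmul R (MulOpposite.op r • t) a = tmul R t (r • a) := by
  refine (QuotientAddGroup.eq_iff_sub_mem).2 ?_
  exact AddSubgroup.subset_closure ⟨t, r, a, rfl⟩

theorem induction_on {p : BalancedTensor R T A → Prop} (x : BalancedTensor R T A)
    (zero : p 0) (tmul : ∀ t a, p (tmul R t a)) (add : ∀ x y, p x → p y → p (x + y)) : p x := by
  obtain ⟨x, rfl⟩ := QuotientAddGroup.mk_surjective x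
  induction x using TensorProduct.induction_on with
  | zero => exact zero
  | tmul t a => exact tmul t a
  | add x y hx hy => exact add _ _ hx hy

/-- The additive map out of `T ⊗_R A` given by a balanced biadditive map. -/
def lift {P : Type*} [AddCommGroup P] (φ : T →+ A →+ P)
    (hφ : ∀ (r : R) t a, φ (MulOpposite.op r • t) a = φ t (r • a)) :
    BalancedTensor R T A →+ P :=
  QuotientAddGroup.lift _
    (TensorProduct.liftAddHom φ fun n t a => by simp)
    ((AddSubgroup.closure_le _).2 (by
      rintro _ ⟨t, r, a, rfl⟩
      simp [hφ]))

@[simp]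
theorem lift_tmul {P : Type*} [AddCommGroup P] (φ : T →+ A →+ P)
    (hφ : ∀ (r : R) t a, φ (MulOpposite.op r • t) a = φ t (r • a)) (t : T) (a : A) :
    lift φ hφ (tmul R t a) = φ t a :=
  rfl

@[simp]
theorem map_tmul (f : A →ₗ[R] B) (t : T) (a : A) : map T f (tmul R t a) = tmul R t (f a) :=
  rfl

end BalancedTensor

/-- A character vanishing on the kernel of an additive map factors through that map. -/
theorem exists_character_comp_eq {X Y : Type*} [AddCommGroup X] [AddCommGroup Y] (φ : X →+ Y)
    (c : X →+ AddCircle (1 : ℚ)) (h : ∀ x, φ x = 0 → c x = 0) :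
    ∃ d : Y →+ AddCircle (1 : ℚ), ∀ x, d (φ x) = c x := by
  obtain ⟨d, hd⟩ := CharacterModule.dual_surjective_of_injective
    (QuotientAddGroup.kerLift φ).toIntLinearMap (QuotientAddGroup.kerLift_injective φ)
    (QuotientAddGroup.lift φ.ker c fun x hx => h x hx)
  exact ⟨d, fun x => DFunLike.congr_fun hd (QuotientAddGroup.mk x)⟩

/-! ### Character modules. -/

section Duals

/-- The group of characters of a left module `B`, regarded as a right module. -/
def RightDual (B : Type u) [AddCommGroup B] : Type u := B →+ AddCircle (1 : ℚ)

/-- The group of characters of a right module `T`, regarded as a left module. -/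
def LeftDual (T : Type u) [AddCommGroup T] : Type u := T →+ AddCircle (1 : ℚ)

instance (B : Type u) [AddCommGroup B] : AddCommGroup (RightDual B) :=
  inferInstanceAs (AddCommGroup (B →+ AddCircle (1 : ℚ)))

instance (T : Type u) [AddCommGroup T] : AddCommGroup (LeftDual T) :=
  inferInstanceAs (AddCommGroup (T →+ AddCircle (1 : ℚ)))

/-- Evaluation of characters. -/
def RightDual.eval {B : Type u} [AddCommGroup B] : RightDual B →+ B →+ AddCircle (1 : ℚ) :=
  AddMonoidHom.id (B →+ AddCircle (1 : ℚ))

/-- Evaluation of characters. -/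
def LeftDual.eval {T : Type u} [AddCommGroup T] : LeftDual T →+ T →+ AddCircle (1 : ℚ) :=
  AddMonoidHom.id (T →+ AddCircle (1 : ℚ))

theorem RightDual.ext {B : Type u} [AddCommGroup B] {c d : RightDual B}
    (h : ∀ b, c.eval b = d.eval b) : c = d :=
  AddMonoidHom.ext h

theorem LeftDual.ext {T : Type u} [AddCommGroup T] {c d : LeftDual T}
    (h : ∀ t, c.eval t = d.eval t) : c = d :=
  AddMonoidHom.ext h

variable {R : Type u} [Ring R]

instance (B : Type u) [AddCommGroup B] [Module R B] : Module Rᵐᵒᵖ (RightDual B) where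
  smul r c := AddMonoidHom.comp (c.eval) (DistribSMul.toAddMonoidHom B r.unop)
  one_smul c := RightDual.ext fun b => congrArg c.eval (one_smul R b)
  mul_smul r s c := RightDual.ext fun b => congrArg c.eval (mul_smul s.unop r.unop b)
  smul_zero _ := rfl
  smul_add _ _ _ := rfl
  add_smul r s c := RightDual.ext fun b =>
    (congrArg c.eval (add_smul r.unop s.unop b)).trans (map_add c.eval _ _)
  zero_smul c := RightDual.ext fun b =>
    (congrArg c.eval (zero_smul R b)).trans (map_zero c.eval)

instance (T : Type u) [AddCommGroup T] [Module Rᵐᵒᵖ T] : Module R (LeftDual T) where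
  smul r c := AddMonoidHom.comp (c.eval) (DistribSMul.toAddMonoidHom T (MulOpposite.op r))
  one_smul c := LeftDual.ext fun t => congrArg c.eval (one_smul Rᵐᵒᵖ t)
  mul_smul r s c := LeftDual.ext fun t =>
    congrArg c.eval (mul_smul (MulOpposite.op s) (MulOpposite.op r) t)
  smul_zero _ := rfl
  smul_add _ _ _ := rfl
  add_smul r s c := LeftDual.ext fun t =>
    (congrArg c.eval (add_smul (MulOpposite.op r) (MulOpposite.op s) t)).trans
      (map_add c.eval _ _)
  zero_smul c := LeftDual.ext fun t =>
    (congrArg c.eval (zero_smul Rᵐᵒᵖ t)).trans (map_zero c.eval)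

@[simp]
theorem RightDual.eval_smul {B : Type u} [AddCommGroup B] [Module R B] (r : R) (c : RightDual B)
    (b : B) : (MulOpposite.op r • c).eval b = c.eval (r • b) :=
  rfl

@[simp]
theorem LeftDual.eval_smul {T : Type u} [AddCommGroup T] [Module Rᵐᵒᵖ T] (r : R)
    (c : LeftDual T) (t : T) : (r • c).eval t = c.eval (MulOpposite.op r • t) :=
  rfl

/-- The map of right modules dual to a map of left modules. -/
def RightDual.map {B C : Type u} [AddCommGroup B] [Module R B] [AddCommGroup C] [Module R C]
    (f : B →ₗ[R] C) : RightDual C →ₗ[Rᵐᵒᵖ] RightDual B where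
  toFun c := AddMonoidHom.comp c.eval f.toAddMonoidHom
  map_add' _ _ := rfl
  map_smul' r c := RightDual.ext fun b => congrArg c.eval (map_smul f r.unop b).symm

/-- The map of left modules dual to a map of right modules. -/
def LeftDual.map {T U : Type u} [AddCommGroup T] [Module Rᵐᵒᵖ T] [AddCommGroup U]
    [Module Rᵐᵒᵖ U] (f : T →ₗ[Rᵐᵒᵖ] U) : LeftDual U →ₗ[R] LeftDual T where
  toFun c := AddMonoidHom.comp c.eval f.toAddMonoidHom
  map_add' _ _ := rfl
  map_smul' r c := LeftDual.ext fun t =>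
    congrArg c.eval (map_smul f (MulOpposite.op r) t).symm

theorem RightDual.map_injective {B C : Type u} [AddCommGroup B] [Module R B] [AddCommGroup C]
    [Module R C] (f : B →ₗ[R] C) (hf : Function.Surjective f) :
    Function.Injective (RightDual.map f) := by
  intro c d h
  refine RightDual.ext fun x => ?_
  obtain ⟨b, rfl⟩ := hf x
  exact DFunLike.congr_fun (congrArg RightDual.eval h) b

theorem LeftDual.map_surjective {T U : Type u} [AddCommGroup T] [Module Rᵐᵒᵖ T] [AddCommGroup U]
    [Module Rᵐᵒᵖ U] (f : T →ₗ[Rᵐᵒᵖ] U) (hf : Function.Injective f) :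
    Function.Surjective (LeftDual.map f) := by
  intro c
  obtain ⟨d, hd⟩ := exists_character_comp_eq f.toAddMonoidHom c.eval fun t ht => by
    rw [(map_eq_zero_iff f hf).1 ht, map_zero]
  exact ⟨d, LeftDual.ext hd⟩

/-! ### Tensor-hom adjunction and the pairing of `B⁺ ⊗ A` with `Hom(A, B)`. -/

variable {A : Type u} [AddCommGroup A] [Module R A]

/-- The character of `T ⊗_R A` given by a linear map from `A` to the dual of `T`. -/
def LeftDual.uncurry {T : Type u} [AddCommGroup T] [Module Rᵐᵒᵖ T] (g : A →ₗ[R] LeftDual T) :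
    BalancedTensor R T A →+ AddCircle (1 : ℚ) :=
  BalancedTensor.lift (LeftDual.eval.comp g.toAddMonoidHom).flip fun r t a => by
    simp

/-- The linear map from `A` to the dual of `T` given by a character of `T ⊗_R A`. -/
def LeftDual.curry {T : Type u} [AddCommGroup T] [Module Rᵐᵒᵖ T]
    (c : BalancedTensor R T A →+ AddCircle (1 : ℚ)) : A →ₗ[R] LeftDual T where
  toFun a := c.comp ((BalancedTensor.tmul R).flip a)
  map_add' a b := LeftDual.ext fun t =>
    (congrArg c (map_add (BalancedTensor.tmul R t) a b)).trans (map_add c _ _)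
  map_smul' r a := LeftDual.ext fun t => congrArg c (BalancedTensor.smul_tmul r t a).symm

/-- Since `Hom(A, T⁺)` is `(T ⊗ A)⁺`, extending maps from `A` to `M` means extending characters
along `T ⊗ A → T ⊗ M`. As `ℚ/ℤ` is an injective cogenerator, this is always possible iff that map is
injective. -/
theorem isRelFlat_iff_isRelInjective_leftDual {M : Type u} [AddCommGroup M] [Module R M]
    {𝒜 : Set (Submodule R M)} {T : Type u} [AddCommGroup T] [Module Rᵐᵒᵖ T] :
    IsRelFlat 𝒜 T ↔ IsRelInjective 𝒜 (LeftDual T) := by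
  refine forall₂_congr fun A hA => ⟨fun h f => ?_, fun h => ?_⟩
  · obtain ⟨d, hd⟩ := exists_character_comp_eq (BalancedTensor.map T A.subtype)
      (LeftDual.uncurry f) fun x hx => by rw [(map_eq_zero_iff _ h).1 hx, map_zero]
    exact ⟨LeftDual.curry d, LinearMap.ext fun a => LeftDual.ext fun t =>
      hd (BalancedTensor.tmul R t a)⟩
  · refine (injective_iff_map_eq_zero _).2 fun x hx => ?_
    refine CharacterModule.eq_zero_of_character_apply fun c => ?_
    obtain ⟨g, hg⟩ := h (LeftDual.curry c)
    have key (y : BalancedTensor R T A) :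
        LeftDual.uncurry g (BalancedTensor.map T A.subtype y) = c y := by
      induction y using BalancedTensor.induction_on with
      | zero => exact (map_zero (LeftDual.uncurry g)).trans (map_zero c).symm
      | tmul t a => exact DFunLike.congr_fun (congrArg LeftDual.eval (LinearMap.congr_fun hg a)) t
      | add y z hy hz => rw [map_add, map_add, hy, hz]; exact (map_add c y z).symm
    rw [← key, hx, map_zero]

/-- The canonical map from `B⁺ ⊗_R A` to the characters of `Hom_R(A, B)`. -/
def RightDual.homPairing (A B : Type u) [AddCommGroup A] [Module R A] [AddCommGroup B]
    [Module R B] :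
    BalancedTensor R (RightDual B) A →+ (A →ₗ[R] B) →+ AddCircle (1 : ℚ) :=
  BalancedTensor.lift
    (AddMonoidHom.mk' (fun c => AddMonoidHom.mk'
      (fun a => c.eval.comp (LinearMap.evalAddMonoidHom a))
      fun a b => by ext f; simp)
      fun c d => by ext a f; simp)
    fun r c a => by ext f; simp

@[simp]
theorem RightDual.homPairing_tmul {B : Type u} [AddCommGroup B] [Module R B] (c : RightDual B)
    (a : A) (f : A →ₗ[R] B) :
    RightDual.homPairing A B (BalancedTensor.tmul R c a) f = c.eval (f a) :=
  rfl

theorem RightDual.homPairing_map {A' B : Type u} [AddCommGroup A'] [Module R A'] [AddCommGroup B]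
    [Module R B] (i : A →ₗ[R] A') (x : BalancedTensor R (RightDual B) A) (f : A' →ₗ[R] B) :
    RightDual.homPairing A' B (BalancedTensor.map _ i x) f =
      RightDual.homPairing A B x (f ∘ₗ i) := by
  induction x using BalancedTensor.induction_on with
  | zero => simp
  | tmul c a => rfl
  | add x y hx hy => simp only [map_add, AddMonoidHom.add_apply, hx, hy]

theorem character_pi_apply {ι : Type*} [Fintype ι] [DecidableEq ι] {B : Type*} [AddCommGroup B]
    (c : (ι → B) →+ AddCircle (1 : ℚ)) (x : ι → B) :
    c x = ∑ i, c.comp (AddMonoidHom.single (fun _ => B) i) (x i) := by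
  conv_lhs => rw [← Finset.univ_sum_single x]
  simp [map_sum]

/-- Values on `n` generators embed `Hom(A, B)` in `Bⁿ`; a character extends to `Bⁿ`, and its
components are the coefficients of a tensor. -/
theorem RightDual.homPairing_surjective [Module.Finite R A] (B : Type u) [AddCommGroup B]
    [Module R B] : Function.Surjective (RightDual.homPairing (R := R) A B) := by
  intro χ
  obtain ⟨n, s, hs⟩ := Module.Finite.exists_fin (R := R) (M := A)
  let φ : (A →ₗ[R] B) →+ (Fin n → B) :=
    AddMonoidHom.mk' (fun f i => f (s i)) fun f g => rfl
  obtain ⟨d, hd⟩ := exists_character_comp_eq φ χ fun f hf => by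
    have : f = 0 := LinearMap.ext_on_range hs fun i => congrFun hf i
    rw [this, map_zero]
  refine ⟨∑ i, BalancedTensor.tmul R
    (show RightDual B from d.comp (AddMonoidHom.single (fun _ => B) i)) (s i), ?_⟩
  ext f
  rw [← hd, character_pi_apply, map_sum, AddMonoidHom.finsetSum_apply]
  rfl

theorem BalancedTensor.exists_eq_sum_tmul {T : Type u} [AddCommGroup T] [Module Rᵐᵒᵖ T]
    {ι : Type*} [Fintype ι] {s : ι → A} (hs : Submodule.span R (Set.range s) = ⊤)
    (x : BalancedTensor R T A) : ∃ c : ι → T, x = ∑ i, BalancedTensor.tmul R (c i) (s i) := by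
  induction x using BalancedTensor.induction_on with
  | zero => exact ⟨0, by simp⟩
  | tmul t a =>
    obtain ⟨r, rfl⟩ := (Submodule.mem_span_range_iff_exists_fun R).1 
      (hs ▸ Submodule.mem_top (x := a))
    exact ⟨fun i => MulOpposite.op (r i) • t, by simp [BalancedTensor.smul_tmul]⟩
  | add x y hx hy =>
    obtain ⟨c, rfl⟩ := hx
    obtain ⟨d, rfl⟩ := hy
    exact ⟨c + d, by simp [Finset.sum_add_distrib]⟩

/-- Take a presentation `q`, `p` of `A` and write `x = ∑ c i ⊗ s i`. Vanishing of the pairing says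
that the character `∑ c i` of `Bⁿ` kills all tuples satisfying the relations. It therefore factors
through the relations, and so `x` is a sum of tensors with zero second factor. -/
theorem RightDual.homPairing_injective [Module.FinitePresentation R A] (B : Type u)
    [AddCommGroup B] [Module R B] :
    Function.Injective (RightDual.homPairing (R := R) A B) := by
  refine (injective_iff_map_eq_zero _).2 fun x hx => ?_
  obtain ⟨n, m, p, q, hp, hpq⟩ := Module.FinitePresentation.exists_fin' R A
  let s : Fin n → A := fun i => p (Pi.single i 1)
  have hps (v : Fin n → R) : p v = ∑ i, v i • s i := by
    conv_lhs => rw [pi_eq_sum_univ' v]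
    simp [s, map_sum]
  have hs : Submodule.span R (Set.range s) = ⊤ := by
    refine (Submodule.eq_top_iff').2 fun a => (Submodule.mem_span_range_iff_exists_fun R).2 ?_
    obtain ⟨v, rfl⟩ := hp a
    exact ⟨v, (hps v).symm⟩
  obtain ⟨c, rfl⟩ := BalancedTensor.exists_eq_sum_tmul hs x
  -- `ρ` evaluates the `m` relations on a tuple; a tuple in its kernel is the family of values `f (s
  -- i)` of some `f : A → B`.
  let ρ : (Fin n → B) →+ (Fin m → B) :=
    AddMonoidHom.mk' (fun b j => ∑ i, q (Pi.single j 1) i • b i) fun b b' => by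
      ext j
      simp [Finset.sum_add_distrib]
  have hρ (b : Fin n → B) (j : Fin m) : ρ b j = ∑ i, q (Pi.single j 1) i • b i := rfl
  let χ : (Fin n → B) →+ AddCircle (1 : ℚ) :=
    ∑ i, (c i).eval.comp (Pi.evalAddMonoidHom (fun _ => B) i)
  have hχ (b : Fin n → B) : χ b = ∑ i, (c i).eval (b i) := by
    simp [χ]
  obtain ⟨d, hd⟩ := exists_character_comp_eq ρ χ fun b hb => by
    let l : (Fin n → R) →ₗ[R] B := Fintype.linearCombination R b
    have hl (v : Fin n → R) : l v = ∑ i, v i • b i := Fintype.linearCombination_apply R b v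
    have hlq : l ∘ₗ q = 0 := by
      refine LinearMap.pi_ext' fun j => LinearMap.ext_ring ?_
      simpa [hl] using (hρ b j).symm.trans (congrFun hb j)
    have hker : LinearMap.ker p ≤ LinearMap.ker l := by
      intro v hv
      obtain ⟨w, rfl⟩ := (hpq v).1 hv
      exact LinearMap.congr_fun hlq w
    let f : A →ₗ[R] B := (LinearMap.ker p).liftQ l hker ∘ₗ
      (p.quotKerEquivOfSurjective hp).symm.toLinearMap
    have hf (v : Fin n → R) : f (p v) = l v := by
      have : (p.quotKerEquivOfSurjective hp).symm (p v) = Submodule.Quotient.mk v := by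
        rw [LinearEquiv.symm_apply_eq]
        simp
      simp [f, this]
    have := DFunLike.congr_fun hx f
    rw [hχ]
    simpa [s, hf, l] using this
  let d' : Fin m → RightDual B := fun j => d.comp (AddMonoidHom.single (fun _ => B) j)
  -- Testing `χ = d ∘ ρ` on tuples supported at `i` isolates `c i`.
  have hc (i : Fin n) : c i = ∑ j, MulOpposite.op (q (Pi.single j 1) i) • d' j := by
    refine RightDual.ext fun b => ?_
    have h1 : χ (Pi.single i b) = (c i).eval b := by
      rw [hχ, Finset.sum_eq_single i]
      · simp
      · intro k _ hk
        simp [hk]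
      · simp
    have h2 (j : Fin m) : ρ (Pi.single i b) j = q (Pi.single j 1) i • b := by
      rw [hρ, Finset.sum_eq_single i]
      · simp
      · intro k _ hk
        simp [hk]
      · simp
    rw [← h1, ← hd, character_pi_apply, map_sum, AddMonoidHom.finsetSum_apply]
    exact Finset.sum_congr rfl fun j _ => by rw [h2]; rfl
  simp_rw [hc, map_sum, AddMonoidHom.finsetSum_apply, BalancedTensor.smul_tmul]
  rw [Finset.sum_comm]
  simp_rw [← map_sum, ← hps, hpq.apply_apply_eq_zero, map_zero, Finset.sum_const_zero]

/-! ### Exchanging relative flatness and relative injectivity. -/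

variable {M : Type u} [AddCommGroup M] [Module R M] {𝒜 : Set (Submodule R M)}

theorem IsRelInjective.isRelFlat_rightDual (hcoh : IsRelCoherent 𝒜) {B : Type u} [AddCommGroup B]
    [Module R B] (hB : IsRelInjective 𝒜 B) : IsRelFlat 𝒜 (RightDual B) := by
  intro A hA
  have := hcoh A hA
  refine (injective_iff_map_eq_zero _).2 fun x hx => ?_
  refine (injective_iff_map_eq_zero _).1 (RightDual.homPairing_injective (A := A) B) x ?_
  ext f
  obtain ⟨g, rfl⟩ := hB A hA f
  rw [← RightDual.homPairing_map, hx]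
  simp

/-- Surjectivity of restriction `Hom(M, B) → Hom(A, B)` is tested on characters. Those of `Hom(A,
B)` come from tensors, and the pairing for `M` is injective, so the test reduces to injectivity of
`B⁺ ⊗ A → B⁺ ⊗ M`. -/
theorem IsRelFlat.isRelInjective_of_rightDual [Module.FinitePresentation R M]
    (hfg : ∀ A ∈ 𝒜, A.FG) {B : Type u} [AddCommGroup B]
    [Module R B] (hB : IsRelFlat 𝒜 (RightDual B)) : IsRelInjective 𝒜 B := by
  intro A hA
  have : Module.Finite R A := Module.Finite.iff_fg.2 (hfg A hA)
  let res : (M →ₗ[R] B) →+ (A →ₗ[R] B) :=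
    AddMonoidHom.mk' (fun g => g ∘ₗ A.subtype) fun _ _ => rfl
  change Function.Surjective res.toIntLinearMap
  refine CharacterModule.surjective_of_dual_injective _
    ((injective_iff_map_eq_zero _).2 fun χ hχ => ?_)
  obtain ⟨x, rfl⟩ := RightDual.homPairing_surjective (R := R) (A := A) B χ
  have hx : x = 0 := by
    refine (injective_iff_map_eq_zero _).1 (hB A hA) x ?_
    refine (injective_iff_map_eq_zero _).1 (RightDual.homPairing_injective (A := M) B) _ ?_
    ext g
    rw [RightDual.homPairing_map]
    exact DFunLike.congr_fun hχ g
  rw [hx]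
  exact map_zero (RightDual.homPairing A B)

/-- Invariance of flatness under isomorphism is obtained on the duals, from that of relative
injectivity. -/
theorem RelFlatSubmoduleClosed.isRelFlat_of_injective (h : RelFlatSubmoduleClosed 𝒜)
    {T U : Type u} [AddCommGroup T] [Module Rᵐᵒᵖ T] [AddCommGroup U] [Module Rᵐᵒᵖ U]
    (hT : IsRelFlat 𝒜 T) (f : U →ₗ[Rᵐᵒᵖ] T) (hf : Function.Injective f) : IsRelFlat 𝒜 U := by
  have hr := isRelFlat_iff_isRelInjective_leftDual.1 (h T hT (LinearMap.range f))
  let e := LinearEquiv.ofInjective f hf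
  refine isRelFlat_iff_isRelInjective_leftDual.2 (hr.of_equiv
    (LinearEquiv.ofLinearMap (LeftDual.map e.toLinearMap) (LeftDual.map e.symm.toLinearMap) ?_ ?_))
  · exact LinearMap.ext fun c => LeftDual.ext fun t => congrArg c.eval (e.symm_apply_apply t)
  · exact LinearMap.ext fun c => LeftDual.ext fun t => congrArg c.eval (e.apply_symm_apply t)

/-- `(B ⧸ C)⁺` embeds in `B⁺`, which is flat by coherence; dualise back. -/
theorem RelFlatSubmoduleClosed.isQuotientClosed [Module.FinitePresentation R M]
    (hcoh : IsRelCoherent 𝒜) (h : RelFlatSubmoduleClosed 𝒜) :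
    IsQuotientClosed (relInjectives 𝒜) := by
  intro B _ _ hB C
  refine IsRelFlat.isRelInjective_of_rightDual
    (fun A hA => Module.Finite.iff_fg.1 (have := hcoh A hA; inferInstance)) ?_
  exact h.isRelFlat_of_injective (IsRelInjective.isRelFlat_rightDual hcoh hB)
    (RightDual.map C.mkQ) (RightDual.map_injective _ C.mkQ_surjective)

theorem IsPModule.isRelCoherent (hfg : ∀ A ∈ 𝒜, A.FG) (h : IsPModule 𝒜) : IsRelCoherent 𝒜 := by
  intro A hA
  have := h A hA
  have : Module.Finite R A := Module.Finite.iff_fg.2 (hfg A hA)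
  exact Module.finitePresentation_of_projective R A

/-- Characters of `U` extend to `T`, so `U⁺` is a quotient of the relatively injective `T⁺`. -/
theorem IsQuotientClosed.relFlatSubmoduleClosed (h : IsQuotientClosed (relInjectives 𝒜)) :
    RelFlatSubmoduleClosed 𝒜 := by
  intro T _ _ hT U
  rw [isRelFlat_iff_isRelInjective_leftDual] at hT ⊢
  exact h.relInjective_of_surjective hT (LeftDual.map U.subtype)
    (LeftDual.map_surjective _ U.injective_subtype)

theorem IsRelCoherent.fg (h : IsRelCoherent 𝒜) : ∀ A ∈ 𝒜, A.FG := fun A hA =>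
  have := h A hA
  Module.Finite.iff_fg.1 inferInstance

end Duals


theorem proposition3p3 {R : Type u} [Ring R] {M : Type u} [AddCommGroup M] [Module R M]
    (𝒜 : Set (Submodule R M)) :
    -- (1) ⇒ (2)
    (IsPModule 𝒜 → IsQuotientClosed (relInjectives 𝒜)) ∧
    (Module.Projective R M → IsPModule 𝒜 → IsQuotientClosed (stronglyRelInjectives 𝒜)) ∧
    -- (2) ⇒ (1) for `M` projective
    (Module.Projective R M → IsQuotientClosed (relInjectives 𝒜) → IsPModule 𝒜) ∧
    (Module.Projective R M → IsQuotientClosed (stronglyRelInjectives 𝒜) → IsPModule 𝒜) ∧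
    -- (4) ⇒ (2) for `M` projective
    (Module.Projective R M → HasMonicCovers (relInjectives 𝒜) →
      IsQuotientClosed (relInjectives 𝒜)) ∧
    (Module.Projective R M → HasMonicCovers (stronglyRelInjectives 𝒜) →
      IsQuotientClosed (stronglyRelInjectives 𝒜)) ∧
    -- (3) ⇒ (2) for `M` finitely presented
    (Module.FinitePresentation R M → IsRelCoherent 𝒜 ∧ RelFlatSubmoduleClosed 𝒜 →
      IsQuotientClosed (relInjectives 𝒜)) ∧
    (Module.FinitePresentation R M → Module.Projective R M →
      IsRelCoherent 𝒜 ∧ RelFlatSubmoduleClosed 𝒜 →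
      IsQuotientClosed (stronglyRelInjectives 𝒜)) ∧
    -- (2) ⇒ (3) for `M` projective and all members of `𝒜` finitely generated
    ((∀ A ∈ 𝒜, A.FG) → Module.Projective R M → IsQuotientClosed (relInjectives 𝒜) →
      IsRelCoherent 𝒜 ∧ RelFlatSubmoduleClosed 𝒜) ∧
    ((∀ A ∈ 𝒜, A.FG) → Module.Projective R M → IsQuotientClosed (stronglyRelInjectives 𝒜) →
      IsRelCoherent 𝒜 ∧ RelFlatSubmoduleClosed 𝒜) ∧
    -- (2) ⇒ (4) for `M` coherent relative to `𝒜`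
    (IsRelCoherent 𝒜 → IsQuotientClosed (relInjectives 𝒜) → HasMonicCovers (relInjectives 𝒜)) ∧
    (IsRelCoherent 𝒜 → Module.Projective R M → IsQuotientClosed (stronglyRelInjectives 𝒜) →
      HasMonicCovers (stronglyRelInjectives 𝒜)) := by

  refine ⟨fun h => h.isQuotientClosed, fun _ h => ?_, fun _ h => h.isPModule, fun _ h => ?_,
    fun _ h => h.isQuotientClosed, fun _ h => ?_, fun _ h => h.2.isQuotientClosed h.1,
    fun _ _ h => ?_, fun hfg _ h => ⟨h.isPModule.isRelCoherent hfg, h.relFlatSubmoduleClosed⟩,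
    fun hfg _ h => ?_, fun hcoh h => h.hasMonicCovers hcoh.fg, fun hcoh _ h => ?_⟩ <;>
    rw [stronglyRelInjectives_eq] at *
  · exact h.isQuotientClosed
  · exact h.isPModule
  · exact h.isQuotientClosed
  · exact h.2.isQuotientClosed h.1
  · exact ⟨h.isPModule.isRelCoherent hfg, h.relFlatSubmoduleClosed⟩
  · exact h.hasMonicCovers hcoh.fg
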